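/- Let $c\in\mathbb R$ and $T>0$. Let $X_c^2$ be the space of all measurable $f:\mathbb R^+\to\mathbb C$ with $\int_0^\infty |f(u)|^2u^{2c-1}\,du<\infty$. For $f\in X_c^2$ let $M^2[f](c+it)$ be its Mellin transform, that is, the limit in $L^2(\mathbb R)$ (as a function of $t$), as $\rho\to+\infty$, of $\int_{1/\rho}^{\rho}f(u)u^{c+it-1}\,du$. Let $B^2_{c,T}$ be the space of all continuous $f\in X_c^2$ with $M^2[f](c+it)=0$ for almost all $t$ with $|t|>T$. Let $\widetilde B^2_{c,T}$ be the space of all $f\in X_c^2$ for which $g(x):=x^cf(x)$ has an analytic extension to the Riemann surface of the logarithm with properties (iii) and (iv) below; the extension is given by its analytic branches $g_k$ ($k\in\mathbb Z$) on $\Omega:=\mathbb C\setminus[0,\infty)$, which satisfy (i) and (ii): (i) for $x>0$ the limits $g_k^{\pm}(x):=\lim_{\varepsilon\to0+}g_k(x\pm i\varepsilon)$ exist, $g_k^-(x)=g_{k+1}^+(x)$, and $g_0^+(x)=g(x)$; (ii) for $x>0$ and every open disk $U_x$ with centre $x$ in the right half-plane, the function on $U_x$ which equals $g_k(z)$ for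 $\Im z<0$, $g_k^-(z)$ for $\Im z=0$ and $g_{k+1}(z)$ for $\Im z>0$ is analytic; (iii) there is a constant $C>0$ such that $|g_k(re^{i\theta})|\le Ce^{T|2\pi k+\theta|}$ for all $k\in\mathbb Z$, $\theta\in[0,2\pi]$ and $r>0$; (iv) for every $k\in\mathbb Z$, $\lim_{r\to0}g_k(re^{i\theta})=\lim_{r\to\infty}g_k(re^{i\theta})=0$ uniformly in $\theta\in[0,2\pi]$; where in (iii) and (iv) $g_k(re^{i\theta})$ means $g_k^+(r)$ if $\theta=0$ and $g_k^-(r)$ if $\theta=2\pi$. Then $\widetilde B^2_{c,T}\subset B^2_{c,T}$. Moreover, for every $f\in\widetilde B^2_{c,T}$, the support of $t\mapsto M^2[f](c+it)$, that is, the set of all $t_0\in\mathbb R$ that have no neighbourhood throughout which $M^2[f](c+it)=0$ almost everywhere, is contained in $[-T,T]$. -/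

import Mathlib

open MeasureTheory Set Filter Topology

noncomputable section

/- Functions on the half-line of positive reals are represented by functions on the real line; every
notion below uses only their values at positive arguments. -/

/-- The space `X_c^2`: measurable `f` with `x ^ (c - 1/2) * f x` square integrable on the positive
half-line. -/
def MellinX2 (c : ℝ) : Set (ℝ → ℂ) :=
  {f | MemLp (fun x : ℝ => ((x ^ (c - 1 / 2) : ℝ) : ℂ) * f x) 2 (volume.restrict (Ioi 0))}

/-- The truncated Mellin integral of `f` over `[1/ρ, ρ]` at the point `c + i t`. -/
def truncatedMellin (c : ℝ) (f : ℝ → ℂ) (ρ t : ℝ) : ℂ :=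
  ∫ u in (1 / ρ)..ρ, f u * (u : ℂ) ^ ((c : ℂ) + (t : ℂ) * Complex.I - 1)

/-- `F` is (a representative of) the function `t ↦ M²[f](c + i t)`: it is square integrable, and it
is the limit in the mean of the truncated Mellin integrals. -/
def IsMellinL2 (c : ℝ) (f F : ℝ → ℂ) : Prop :=
  MemLp F 2 volume ∧
    Tendsto (fun ρ : ℝ => eLpNorm (fun t : ℝ => F t - truncatedMellin c f ρ t) 2 volume)
      atTop (𝓝 0)

/-- The support of a function defined up to null sets: the points that have no neighbourhood
throughout which `F` vanishes almost everywhere. -/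
def essSupport (F : ℝ → ℂ) : Set ℝ :=
  {t | ¬ ∃ U ∈ 𝓝 t, ∀ᵐ s ∂(volume : Measure ℝ), s ∈ U → F s = 0}

/-- The space `B_{c,T}^2` of Mellin bandlimited functions: the continuous functions in `X_c^2`
whose Mellin transform `M²[f](c + i t)` vanishes for almost all `t` with `|t| > T`. -/
def MellinBandlimited (c T : ℝ) : Set (ℝ → ℂ) :=
  {f | f ∈ MellinX2 c ∧ ContinuousOn f (Ioi 0) ∧
    ∃ F : ℝ → ℂ, IsMellinL2 c f F ∧ ∀ᵐ t ∂(volume : Measure ℝ), T < |t| → F t = 0}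

/-- The complex plane cut along the nonnegative real axis. -/
def cutPlane : Set ℂ :=
  {z | ¬ (0 ≤ z.re ∧ z.im = 0)}

/-- The value at `r * exp (i θ)`, for `r > 0` and `0 ≤ θ ≤ 2π`, of a function `G` on the cut plane
with boundary values `Gp` on the upper and `Gm` on the lower side of the cut. -/
def polarValue (G : ℂ → ℂ) (Gp Gm : ℝ → ℂ) (r θ : ℝ) : ℂ :=
  if θ = 0 then Gp r
  else if θ = 2 * Real.pi then Gm r
  else G ((r : ℂ) * Complex.exp ((θ : ℂ) * Complex.I))

/-- The function which is `G` below the real axis, `Gm` on it and `H` above it. -/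
def gluedAcross (G : ℂ → ℂ) (Gm : ℝ → ℂ) (H : ℂ → ℂ) (z : ℂ) : ℂ :=
  if z.im < 0 then G z else if z.im = 0 then Gm z.re else H z

/-- `G k`, `k ∈ ℤ`, are the branches on the cut plane (the sheets, on which the argument ranges
over `(2πk, 2πk + 2π)`) of an analytic extension to the Riemann surface of the logarithm of the
function `g` given on the positive half-line; `Gp k` and `Gm k` are the boundary values of `G k`
from above and from below the cut. -/
structure IsLogSurfaceExtension (g : ℝ → ℂ) (G : ℤ → ℂ → ℂ) (Gp Gm : ℤ → ℝ → ℂ) : Prop where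
  analytic : ∀ k, AnalyticOnNhd ℂ (G k) cutPlane
  limit_above : ∀ k, ∀ x : ℝ, 0 < x →
    Tendsto (fun ε : ℝ => G k ((x : ℂ) + (ε : ℂ) * Complex.I)) (𝓝[>] 0) (𝓝 (Gp k x))
  limit_below : ∀ k, ∀ x : ℝ, 0 < x →
    Tendsto (fun ε : ℝ => G k ((x : ℂ) - (ε : ℂ) * Complex.I)) (𝓝[>] 0) (𝓝 (Gm k x))
  next_sheet : ∀ k, ∀ x : ℝ, 0 < x → Gm k x = Gp (k + 1) x
  extends_base : ∀ x : ℝ, 0 < x → Gp 0 x = g x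
  analytic_across : ∀ k, ∀ x δ : ℝ, 0 < δ → δ ≤ x →
    AnalyticOnNhd ℂ (gluedAcross (G k) (Gm k) (G (k + 1))) (Metric.ball (x : ℂ) δ)

/-- The Mellin-Bernstein space: the functions in `X_c^2` such that `x ^ c * f x` has an analytic
extension to the Riemann surface of the logarithm whose branches satisfy the growth bound and the
uniform decay at `0` and at `∞`. -/
def MellinBernstein (c T : ℝ) : Set (ℝ → ℂ) :=
  {f | f ∈ MellinX2 c ∧
    ∃ (G : ℤ → ℂ → ℂ) (Gp Gm : ℤ → ℝ → ℂ),
      IsLogSurfaceExtension (fun x : ℝ => ((x ^ c : ℝ) : ℂ) * f x) G Gp Gm ∧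
      (∃ C : ℝ, 0 < C ∧ ∀ k : ℤ, ∀ θ ∈ Icc (0 : ℝ) (2 * Real.pi), ∀ r : ℝ, 0 < r →
        ‖polarValue (G k) (Gp k) (Gm k) r θ‖ ≤
          C * Real.exp (T * |2 * Real.pi * (k : ℝ) + θ|)) ∧
      (∀ k : ℤ,
        TendstoUniformlyOn (fun r θ : ℝ => polarValue (G k) (Gp k) (Gm k) r θ)
          (fun _ => 0) (𝓝[>] 0) (Icc 0 (2 * Real.pi)) ∧
        TendstoUniformlyOn (fun r θ : ℝ => polarValue (G k) (Gp k) (Gm k) r θ)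
          (fun _ => 0) atTop (Icc 0 (2 * Real.pi)))}

end

/-! The exponential map identifies the Riemann surface of the logarithm with `ℂ`, so the branches of
`x ^ c * f x` glue to one entire function `H` with `‖H w‖ ≤ C * exp (T * |Im w|)` that tends to zero
along horizontal lines (`exists_entire_of_mem_MellinBernstein`). Under `x = exp s` the Mellin
transform on the line `c + i t` becomes the Fourier transform of `H` on `ℝ`, with kernel `exp (i t
s)`, and `X_c^2` becomes `L²(ℝ)`.

For `t > T`, Cauchy's theorem moves the integral over `[-R, R]` upwards. The kernel beats the growth
of `H`, so the top edge disappears, and the two vertical half-lines contribute `o(1)` as `R → ∞` by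
dominated convergence. Reflection handles `t < -T`. Hence the truncated integrals tend to zero
pointwise for `|t| > T`. They also converge in `L²` to the transform (Plancherel), so a subsequence
converges to it almost everywhere, and the two limits agree. -/

open scoped FourierTransform ContDiff

/-! ### Contour shift for entire functions of exponential type -/

/-- Shifting the contour upwards bounds a truncated Fourier integral of an entire function of
exponential type by integrals over two vertical half-lines. -/
theorem norm_intervalIntegral_mul_cexp_le {H : ℂ → ℂ} {C T t : ℝ} (hH : Differentiable ℂ H)
    (hC : ∀ w, ‖H w‖ ≤ C * Real.exp (T * |w.im|)) (ht : T < t) {R : ℝ} (hR : 0 ≤ R) :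
    ‖∫ s in (-R)..R, H (s : ℂ) * Complex.exp (t * s * Complex.I)‖ ≤
      ∫ y in Ioi (0 : ℝ), (‖H (R + y * Complex.I)‖ + ‖H ((-R : ℝ) + y * Complex.I)‖) *
        Real.exp (-(t * y)) := by
  set Φ : ℂ → ℂ := fun w => H w * Complex.exp (t * w * Complex.I) with hΦ
  have hHc := hH.continuous
  have hΦd : Differentiable ℂ Φ := by fun_prop
  have hΦc := hΦd.continuous
  have hnorm : ∀ x y : ℝ, ‖Φ (x + y * Complex.I)‖ =
      ‖H (x + y * Complex.I)‖ * Real.exp (-(t * y)) := by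
    intro x y
    simp [hΦ, Complex.norm_exp]
  have hbd : ∀ x y : ℝ, 0 ≤ y → ‖Φ (x + y * Complex.I)‖ ≤ C * Real.exp (-(t - T) * y) := by
    intro x y hy
    have h := hC (x + y * Complex.I)
    simp only [Complex.add_im, Complex.ofReal_im, Complex.mul_im, Complex.ofReal_re,
      Complex.I_im, mul_one, Complex.I_re, mul_zero, add_zero, zero_add, abs_of_nonneg hy] at h
    calc _ = ‖H (x + y * Complex.I)‖ * Real.exp (-(t * y)) := hnorm x y
      _ ≤ C * Real.exp (T * y) * Real.exp (-(t * y)) := by gcongr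
      _ = _ := by rw [mul_assoc, ← Real.exp_add]; ring_nf
  have hint : ∀ x : ℝ, IntegrableOn (fun y : ℝ => ‖Φ (x + y * Complex.I)‖) (Ioi 0) := by
    intro x
    refine Integrable.mono' ((integrableOn_exp_mul_Ioi (a := -(t - T)) (by linarith) 0).const_mul C)
      (by fun_prop) ?_
    filter_upwards [ae_restrict_mem measurableSet_Ioi] with y hy
    simpa using hbd x y (le_of_lt hy)
  have hside : ∀ x Y : ℝ, 0 ≤ Y → ‖∫ y in (0 : ℝ)..Y, Φ (x + y * Complex.I)‖ ≤
      ∫ y in Ioi (0 : ℝ), ‖Φ (x + y * Complex.I)‖ := by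
    intro x Y hY
    refine (intervalIntegral.norm_integral_le_integral_norm hY).trans ?_
    rw [intervalIntegral.integral_of_le hY]
    exact setIntegral_mono_set (hint x) (Eventually.of_forall fun _ => norm_nonneg _)
      (Eventually.of_forall fun y hy => hy.1)
  have hkey : ∀ Y : ℝ, 0 ≤ Y → ‖∫ s in (-R)..R, Φ (s : ℂ)‖ ≤
      C * Real.exp (-(t - T) * Y) * (2 * R) +
        ((∫ y in Ioi (0 : ℝ), ‖Φ (R + y * Complex.I)‖) +
        ∫ y in Ioi (0 : ℝ), ‖Φ ((-R : ℝ) + y * Complex.I)‖) := by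
    intro Y hY
    -- Cauchy's theorem on the rectangle with opposite corners `-R` and `R + iY`.
    have h := Complex.integral_boundary_rect_eq_zero_of_differentiableOn Φ ((-R : ℝ) : ℂ)
      (R + Y * Complex.I) hΦd.differentiableOn
    simp only [Complex.ofReal_re, Complex.ofReal_im, Complex.add_re, Complex.add_im,
      Complex.mul_re, Complex.mul_im, Complex.I_re, Complex.I_im, mul_zero, mul_one, zero_mul,
      add_zero, zero_add, sub_self, Complex.ofReal_zero] at h
    have h2 : (∫ s in (-R)..R, Φ (s : ℂ)) = (∫ x in (-R)..R, Φ (x + Y * Complex.I)) +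
        (- (Complex.I • ∫ y in (0 : ℝ)..Y, Φ (R + y * Complex.I)) +
        Complex.I • ∫ y in (0 : ℝ)..Y, Φ ((-R : ℝ) + y * Complex.I)) := by
      linear_combination h
    rw [h2]
    refine (norm_add_le _ _).trans (add_le_add ?_ ((norm_add_le _ _).trans (add_le_add ?_ ?_)))
    · have := intervalIntegral.norm_integral_le_of_norm_le_const (a := -R) (b := R)
        (f := fun x : ℝ => Φ (x + Y * Complex.I)) (fun x _ => hbd x Y hY)
      rwa [sub_neg_eq_add, ← two_mul, abs_of_nonneg (by positivity)] at this
    · simpa [norm_smul] using hside R Y hY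
    · simpa only [norm_smul, Complex.norm_I, one_mul] using hside (-R) Y hY
  -- With `R` fixed, the top edge vanishes as `Y → ∞` because `t > T`.
  have hlim : Tendsto (fun Y : ℝ => C * Real.exp (-(t - T) * Y) * (2 * R) +
        ((∫ y in Ioi (0 : ℝ), ‖Φ (R + y * Complex.I)‖) +
        ∫ y in Ioi (0 : ℝ), ‖Φ ((-R : ℝ) + y * Complex.I)‖)) atTop
      (𝓝 (C * 0 * (2 * R) + ((∫ y in Ioi (0 : ℝ), ‖Φ (R + y * Complex.I)‖) +
        ∫ y in Ioi (0 : ℝ), ‖Φ ((-R : ℝ) + y * Complex.I)‖))) := by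
    refine Tendsto.add_const _ (Tendsto.mul_const _ (Tendsto.const_mul _ ?_))
    exact Real.tendsto_exp_atBot.comp (tendsto_id.const_mul_atTop_of_neg (by linarith))
  have := ge_of_tendsto hlim ((eventually_ge_atTop 0).mono hkey)
  refine this.trans_eq ?_
  rw [mul_zero, zero_mul, zero_add, ← integral_add (hint R) (hint (-R))]
  simp only [hnorm, add_mul]

/-- The truncated Fourier integrals of an entire function of exponential type `T` which decays along
horizontal lines tend to zero at frequencies above `T`. -/
theorem tendsto_intervalIntegral_mul_cexp_of_lt {H : ℂ → ℂ} {C T t : ℝ} (hH : Differentiable ℂ H)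
    (hC : ∀ w, ‖H w‖ ≤ C * Real.exp (T * |w.im|))
    (htop : ∀ y : ℝ, Tendsto (fun s : ℝ => H (s + y * Complex.I)) atTop (𝓝 0))
    (hbot : ∀ y : ℝ, Tendsto (fun s : ℝ => H (s + y * Complex.I)) atBot (𝓝 0)) (ht : T < t) :
    Tendsto (fun R : ℝ => ∫ s in (-R)..R, H (s : ℂ) * Complex.exp (t * s * Complex.I)) atTop
      (𝓝 0) := by
  have hHc := hH.continuous
  refine squeeze_zero_norm'
    ((eventually_ge_atTop (0 : ℝ)).mono fun R hR =>
      norm_intervalIntegral_mul_cexp_le hH hC ht hR) ?_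
  suffices h : Tendsto (fun R : ℝ => ∫ y in Ioi (0 : ℝ), (‖H (R + y * Complex.I)‖ +
      ‖H ((-R : ℝ) + y * Complex.I)‖) * Real.exp (-(t * y))) atTop
      (𝓝 (∫ _y in Ioi (0 : ℝ), (0 : ℝ))) by
    rwa [integral_zero] at h
  refine MeasureTheory.tendsto_integral_filter_of_dominated_convergence
    (fun y => 2 * C * Real.exp (-(t - T) * y)) ?_ ?_ ?_ ?_
  · exact Eventually.of_forall fun R => by fun_prop
  · refine Eventually.of_forall fun R => ?_
    filter_upwards [ae_restrict_mem measurableSet_Ioi] with y hy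
    have h : ∀ x : ℝ, ‖H (x + y * Complex.I)‖ ≤ C * Real.exp (T * y) := by
      intro x
      simpa [abs_of_pos (mem_Ioi.1 hy)] using hC (x + y * Complex.I)
    rw [Real.norm_of_nonneg (by positivity)]
    calc _ ≤ (C * Real.exp (T * y) + C * Real.exp (T * y)) * Real.exp (-(t * y)) := by
          gcongr
          exacts [h R, h (-R)]
      _ = 2 * C * (Real.exp (T * y) * Real.exp (-(t * y))) := by ring
      _ = _ := by rw [← Real.exp_add]; ring_nf
  · exact (integrableOn_exp_mul_Ioi (a := -(t - T)) (by linarith) 0).const_mul _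
  · refine Eventually.of_forall fun y => ?_
    have h1 := (htop y).norm
    have h2 := ((hbot y).comp tendsto_neg_atTop_atBot).norm
    simpa using (h1.add h2).mul_const (Real.exp (-(t * y)))

/-- For `t < -T`, the reflection `w ↦ -w` preserves all hypotheses on `H` and changes the sign of
the frequency. -/
theorem tendsto_intervalIntegral_mul_cexp_of_lt_abs {H : ℂ → ℂ} {C T t : ℝ}
    (hH : Differentiable ℂ H) (hC : ∀ w, ‖H w‖ ≤ C * Real.exp (T * |w.im|))
    (htop : ∀ y : ℝ, Tendsto (fun s : ℝ => H (s + y * Complex.I)) atTop (𝓝 0))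
    (hbot : ∀ y : ℝ, Tendsto (fun s : ℝ => H (s + y * Complex.I)) atBot (𝓝 0)) (ht : T < |t|) :
    Tendsto (fun R : ℝ => ∫ s in (-R)..R, H (s : ℂ) * Complex.exp (t * s * Complex.I)) atTop
      (𝓝 0) := by
  rcases lt_abs.1 ht with ht | ht
  · exact tendsto_intervalIntegral_mul_cexp_of_lt hH hC htop hbot ht
  · have h := tendsto_intervalIntegral_mul_cexp_of_lt (H := fun w => H (-w)) (C := C)
      (hH.comp differentiable_neg) (fun w => by simpa using hC (-w)) (fun y => ?_) (fun y => ?_) ht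
    · refine h.congr fun R => ?_
      have := intervalIntegral.integral_comp_neg (a := -R) (b := R)
        (fun s : ℝ => H (s : ℂ) * Complex.exp (t * s * Complex.I))
      rw [neg_neg] at this
      rw [← this]
      simp
    · refine ((hbot (-y)).comp tendsto_neg_atTop_atBot).congr fun s => ?_
      simp [add_comm]
    · refine ((htop (-y)).comp tendsto_neg_atBot_atTop).congr fun s => ?_
      simp [add_comm]

/-! ### Truncated Fourier integrals in `L²` -/

/-- The inverse Fourier transform on `L²` is given by the Fourier integral on `L¹ ∩ L²`. -/
theorem MeasureTheory.MemLp.fourierInv_toLp_ae_eq {f : ℝ → ℂ} (h1 : Integrable f)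
    (h2 : MemLp f 2 volume) : (𝓕⁻ (h2.toLp f) : Lp (α := ℝ) ℂ 2 volume) =ᵐ[volume] 𝓕⁻ f := by
  set Ff : Lp (α := ℝ) ℂ 2 volume := 𝓕⁻ (h2.toLp f) with hFf
  have hcont : Continuous (𝓕⁻ f) := by
    have : 𝓕⁻ f = fun x => 𝓕 f (-x) := funext fun x => Real.fourierInv_eq_fourier_neg f x
    rw [this]
    exact (VectorFourier.fourierIntegral_continuous Real.continuous_fourierChar
      (by exact continuous_inner) h1).comp continuous_neg
  -- Both sides are compared against test functions: the `L²` transform is also the distributional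
  -- one, and for integrable `f` Fubini moves the transform from `φ` to `f`.
  refine ae_eq_of_integral_contDiff_smul_eq
    ((Lp.memLp Ff).locallyIntegrable one_le_two) hcont.locallyIntegrable ?_
  intro g g_smooth g_cpt
  have hg₁ : HasCompactSupport (Complex.ofRealCLM ∘ g) := g_cpt.comp_left rfl
  have hg₂ : ContDiff ℝ ∞ (Complex.ofRealCLM ∘ g) := by fun_prop
  set φ : SchwartzMap ℝ ℂ := hg₁.toSchwartzMap hg₂ with hφ
  have hφg : ∀ x, φ x = (g x : ℂ) := fun x => by simp [hφ]
  have e1 : ∫ x, g x • Ff x = ∫ x, φ x • Ff x := by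
    simp [hφg]
  have e2 : ∫ x, φ x • Ff x = ∫ x, (𝓕⁻ φ) x • (h2.toLp f) x := by
    rw [hFf, ← Lp.toTemperedDistribution_apply, ← Lp.fourierInv_toTemperedDistribution_eq,
      TemperedDistribution.fourierInv_apply, Lp.toTemperedDistribution_apply]
  have e3 : ∫ x, (𝓕⁻ φ) x • (h2.toLp f) x = ∫ x, (𝓕⁻ φ) x • f x :=
    integral_congr_ae (h2.coeFn_toLp.mono fun x hx => by simp only [hx])
  have e4 : ∫ x, (𝓕⁻ φ) x • f x = ∫ x, φ x • (𝓕⁻ f) x := by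
    have h := VectorFourier.integral_fourierIntegral_smul_eq_flip (μ := volume) (ν := volume)
      (L := -(innerₗ ℝ)) (f := φ) (g := f) Real.continuous_fourierChar
      (by simp only [LinearMap.neg_apply, innerₗ_apply_apply]; fun_prop) φ.integrable h1
    have hL : (-(innerₗ ℝ)).flip = -(innerₗ ℝ) := by ext; simp
    rw [hL] at h
    rw [SchwartzMap.fourierInv_coe]
    exact h
  rw [e1, e2, e3, e4]
  simp [hφg]

/-- The truncations of a square integrable function to growing intervals converge in `L²`. -/
theorem MeasureTheory.MemLp.tendsto_eLpNorm_sub_indicator_Ioc {f : ℝ → ℂ}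
    (hf : MemLp f 2 volume) :
    Tendsto (fun R : ℝ => eLpNorm (f - (Ioc (-R) R).indicator f) 2 volume) atTop (𝓝 0) := by
  have h2 : ∀ R : ℝ, eLpNorm (f - (Ioc (-R) R).indicator f) 2 volume =
      (∫⁻ x, ‖(f - (Ioc (-R) R).indicator f) x‖ₑ ^ (2 : ℝ)) ^ (1 / (2 : ℝ)) := by
    intro R
    rw [eLpNorm_eq_lintegral_rpow_enorm_toReal (by norm_num) (by norm_num)]
    simp
  simp only [h2]
  have h0 : (0 : ENNReal) = (∫⁻ _x : ℝ, 0) ^ (1 / (2 : ℝ)) := by simp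
  rw [h0]
  refine (ENNReal.continuous_rpow_const.tendsto _).comp ?_
  refine tendsto_lintegral_filter_of_dominated_convergence' (fun x => ‖f x‖ₑ ^ (2 : ℝ)) ?_ ?_ ?_ ?_
  · refine Eventually.of_forall fun R => ?_
    have := (hf.1.sub (hf.1.indicator (measurableSet_Ioc (a := -R) (b := R)))).enorm
    exact this.pow_const _
  · refine Eventually.of_forall fun R => Eventually.of_forall fun x => ?_
    gcongr
    by_cases hx : x ∈ Ioc (-R) R <;> simp [hx]
  · have := lintegral_rpow_enorm_lt_top_of_eLpNorm_lt_top (p := 2) (by norm_num) (by norm_num) hf.2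
    simpa using this.ne
  · refine Eventually.of_forall fun x => tendsto_const_nhds.congr' ?_
    filter_upwards [eventually_gt_atTop |x|] with R hR
    have : x ∈ Ioc (-R) R := ⟨(abs_lt.1 hR).1, (abs_lt.1 hR).2.le⟩
    simp [this]

/-- The truncated Fourier integrals of a continuous, square integrable function converge in
`L²`. -/
theorem exists_tendsto_eLpNorm_sub_intervalIntegral {h : ℝ → ℂ} (hc : Continuous h)
    (h2 : MemLp h 2 volume) :
    ∃ F : ℝ → ℂ, MemLp F 2 volume ∧
      Tendsto (fun R : ℝ => eLpNorm
        (fun t : ℝ => F t - ∫ s in (-R)..R, h s * Complex.exp (t * s * Complex.I)) 2 volume)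
        atTop (𝓝 0) := by
  have hpi := Real.pi_pos
  -- Mathlib's kernel is `exp (2πi v t)`. The substitution `s = 2πv` turns the inverse transform of
  -- `g` into the integral of `h s * exp (i t s)`, and `[-Q, Q]` into `[-R, R]`.
  set g : ℝ → ℂ := fun s => (2 * Real.pi : ℝ) • h (2 * Real.pi * s) with hg
  have hgc : Continuous g := by fun_prop
  have hg2 : MemLp g 2 volume := by
    refine MemLp.const_smul (f := fun s => h (2 * Real.pi * s)) ?_ (2 * Real.pi : ℝ)
    rw [memLp_two_iff_integrable_sq_norm (by fun_prop)] at h2 ⊢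
    exact h2.comp_mul_left' (by positivity)
  refine ⟨(𝓕⁻ (hg2.toLp g) : Lp (α := ℝ) ℂ 2 volume), Lp.memLp _, ?_⟩
  have hR : Tendsto (fun R : ℝ => R / (2 * Real.pi)) atTop atTop :=
    tendsto_id.atTop_div_const (by positivity)
  refine Tendsto.congr' ?_ (hg2.tendsto_eLpNorm_sub_indicator_Ioc.comp hR)
  filter_upwards [eventually_ge_atTop 0] with R hR0
  set Q := R / (2 * Real.pi) with hQ
  have hQ0 : 0 ≤ Q := by positivity
  have hQR : 2 * Real.pi * Q = R := by rw [hQ]; field_simp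
  have hi2 : MemLp ((Ioc (-Q) Q).indicator g) 2 volume := hg2.indicator measurableSet_Ioc
  have hi1 : Integrable ((Ioc (-Q) Q).indicator g) :=
    (hgc.continuousOn.integrableOn_Icc.mono_set Ioc_subset_Icc_self).integrable_indicator
      measurableSet_Ioc
  have hF : ∀ t : ℝ, 𝓕⁻ ((Ioc (-Q) Q).indicator g) t =
      ∫ s in (-R)..R, h s * Complex.exp (t * s * Complex.I) := by
    intro t
    have e1 : ∀ v : ℝ, Complex.exp (↑(2 * Real.pi * inner ℝ v t) * Complex.I) •
        (Ioc (-Q) Q).indicator g v = (Ioc (-Q) Q).indicator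
          (fun v : ℝ => (2 * Real.pi : ℝ) • (h (2 * Real.pi * v) *
            Complex.exp (t * (2 * Real.pi * v : ℝ) * Complex.I))) v := by
      intro v
      by_cases hv : v ∈ Ioc (-Q) Q
      · simp only [indicator_of_mem hv, hg, smul_eq_mul, Complex.real_smul]
        rw [show (↑(2 * Real.pi * inner ℝ v t) * Complex.I : ℂ) =
          t * (2 * Real.pi * v : ℝ) * Complex.I by simp; ring]
        ring
      · simp [hv]
    rw [Real.fourierInv_eq', integral_congr_ae (Eventually.of_forall e1),
      integral_indicator measurableSet_Ioc,
      ← intervalIntegral.integral_of_le (by linarith), intervalIntegral.integral_smul,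
      intervalIntegral.smul_integral_comp_mul_left
        (fun s : ℝ => h s * Complex.exp (t * s * Complex.I)), mul_neg, hQR]
  have e2 : (fun t : ℝ => (𝓕⁻ (hg2.toLp g) : Lp (α := ℝ) ℂ 2 volume) t -
      ∫ s in (-R)..R, h s * Complex.exp (t * s * Complex.I)) =ᵐ[volume]
      (𝓕⁻ ((hg2.sub hi2).toLp (g - (Ioc (-Q) Q).indicator g)) : Lp (α := ℝ) ℂ 2 volume) := by
    have hsub : (𝓕⁻ (hg2.toLp g - hi2.toLp _) : Lp (α := ℝ) ℂ 2 volume) =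
        𝓕⁻ (hg2.toLp g) - 𝓕⁻ (hi2.toLp _) := (Lp.fourierTransformₗᵢ ℝ ℂ).symm.map_sub _ _
    rw [MemLp.toLp_sub hg2 hi2, hsub]
    filter_upwards [Lp.coeFn_sub (𝓕⁻ (hg2.toLp g) : Lp (α := ℝ) ℂ 2 volume) (𝓕⁻ (hi2.toLp _)),
      MemLp.fourierInv_toLp_ae_eq hi1 hi2] with t h3 h4
    rw [h3, Pi.sub_apply, h4, hF]
  rw [eLpNorm_congr_ae e2]
  -- Plancherel: the error on the frequency side has the norm of the truncated tail of `g`.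
  have e3 : ‖(𝓕⁻ ((hg2.sub hi2).toLp (g - (Ioc (-Q) Q).indicator g)) : Lp (α := ℝ) ℂ 2 volume)‖ =
      ‖(hg2.sub hi2).toLp (g - (Ioc (-Q) Q).indicator g)‖ :=
    (Lp.fourierTransformₗᵢ ℝ ℂ).symm.norm_map _
  have e4 := congrArg ENNReal.ofReal e3
  rw [Lp.norm_def, ENNReal.ofReal_toReal (Lp.memLp _).2.ne, Lp.norm_toLp,
    ENNReal.ofReal_toReal (hg2.sub hi2).2.ne] at e4
  exact e4.symm

/-! ### The lift to the logarithmic coordinate -/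

/-- The function on `ℂ`, the logarithmic coordinate of the Riemann surface of the logarithm, which
is made up of the branches `G k` and their boundary values `Gp k` from above the cut. -/
noncomputable def logLift (G : ℤ → ℂ → ℂ) (Gp : ℤ → ℝ → ℂ) (w : ℂ) : ℂ :=
  if w.im = 2 * Real.pi * ⌊w.im / (2 * Real.pi)⌋ then
    Gp ⌊w.im / (2 * Real.pi)⌋ (Real.exp w.re)
  else G ⌊w.im / (2 * Real.pi)⌋ (Complex.exp w)

section LogLift

variable {g : ℝ → ℂ} {G : ℤ → ℂ → ℂ} {Gp Gm : ℤ → ℝ → ℂ}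

theorem logLift_of_mem_Ioo {w : ℂ} {k : ℤ}
    (hw : w.im ∈ Ioo (2 * Real.pi * k) (2 * Real.pi * (k + 1))) :
    logLift G Gp w = G k (Complex.exp w) := by
  have hpi := Real.two_pi_pos
  have hk : ⌊w.im / (2 * Real.pi)⌋ = k := by
    rw [Int.floor_eq_iff, le_div_iff₀ hpi, div_lt_iff₀ hpi]
    exact ⟨by linarith [hw.1], by linarith [hw.2]⟩
  rw [logLift, hk, if_neg hw.1.ne']

theorem logLift_of_im_eq {w : ℂ} {k : ℤ} (hw : w.im = 2 * Real.pi * k) :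
    logLift G Gp w = Gp k (Real.exp w.re) := by
  have hpi := Real.two_pi_pos
  have hk : ⌊w.im / (2 * Real.pi)⌋ = k := by
    rw [hw, mul_div_cancel_left₀ _ hpi.ne', Int.floor_intCast]
  rw [logLift, hk, if_pos hw]

theorem Complex.exp_eq_ofReal_exp_mul_cexp_sub (w : ℂ) (k : ℤ) :
    Complex.exp w = (Real.exp w.re : ℂ) *
      Complex.exp ((w.im - 2 * Real.pi * k : ℝ) * Complex.I) := by
  rw [Complex.ofReal_exp, ← Complex.exp_add]
  conv_lhs => rw [← Complex.re_add_im w]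
  rw [Complex.exp_eq_exp_iff_exists_int]
  exact ⟨k, by push_cast; ring⟩

theorem Complex.exp_im_eq_mul_sin_sub (w : ℂ) (k : ℤ) :
    (Complex.exp w).im = Real.exp w.re * Real.sin (w.im - 2 * Real.pi * k) := by
  rw [Complex.exp_im, show w.im - 2 * Real.pi * k = w.im - k * (2 * Real.pi) by ring,
    Real.sin_sub_int_mul_two_pi]

theorem Complex.exp_re_eq_mul_cos_sub (w : ℂ) (k : ℤ) :
    (Complex.exp w).re = Real.exp w.re * Real.cos (w.im - 2 * Real.pi * k) := by
  rw [Complex.exp_re, show w.im - 2 * Real.pi * k = w.im - k * (2 * Real.pi) by ring,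
    Real.cos_sub_int_mul_two_pi]

theorem exp_mem_cutPlane {w : ℂ} {k : ℤ}
    (hw : w.im ∈ Ioo (2 * Real.pi * k) (2 * Real.pi * (k + 1))) :
    Complex.exp w ∈ cutPlane := by
  have hpi := Real.pi_pos
  rintro ⟨hre, him⟩
  rw [Complex.exp_re_eq_mul_cos_sub w k] at hre
  rw [Complex.exp_im_eq_mul_sin_sub w k] at him
  set θ := w.im - 2 * Real.pi * k with hθ
  have h0 : 0 < θ := by linarith [hw.1]
  have h1 : θ < 2 * Real.pi := by linarith [hw.2]
  have hsin : Real.sin θ = 0 := (mul_eq_zero.1 him).resolve_left (Real.exp_pos _).ne'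
  have hcos : 0 ≤ Real.cos θ := nonneg_of_mul_nonneg_right hre (Real.exp_pos _)
  rcases lt_trichotomy θ Real.pi with h | h | h
  · exact (Real.sin_pos_of_pos_of_lt_pi h0 h).ne' hsin
  · rw [h, Real.cos_pi] at hcos
    linarith
  · have := Real.sin_pos_of_pos_of_lt_pi (x := θ - Real.pi) (by linarith) (by linarith)
    rw [Real.sin_sub_pi] at this
    linarith

/-- On this strip `Im (exp w)` has the sign of `Im w - 2πk`, so the three cases of the gluing match
the sheet below, the seam and the sheet above. -/
theorem logLift_eq_gluedAcross (h : IsLogSurfaceExtension g G Gp Gm) {w : ℂ} {k : ℤ}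
    (hw : |w.im - 2 * Real.pi * k| < Real.pi) :
    logLift G Gp w = gluedAcross (G (k - 1)) (Gm (k - 1)) (G k) (Complex.exp w) := by
  have hpi := Real.pi_pos
  have him := Complex.exp_im_eq_mul_sin_sub w k
  obtain ⟨h1, h2⟩ := abs_lt.1 hw
  rw [gluedAcross]
  rcases lt_trichotomy (w.im - 2 * Real.pi * k) 0 with h0 | h0 | h0
  · have hs := Real.sin_neg_of_neg_of_neg_pi_lt h0 h1
    have : (Complex.exp w).im < 0 := by
      rw [him]
      exact mul_neg_of_pos_of_neg (Real.exp_pos _) hs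
    rw [if_pos this]
    refine logLift_of_mem_Ioo ⟨?_, ?_⟩ <;> push_cast <;> linarith
  · have h3 : (Complex.exp w).im = 0 := by rw [him, h0]; simp
    have h4 : (Complex.exp w).re = Real.exp w.re := by
      rw [Complex.exp_re_eq_mul_cos_sub w k, h0]; simp
    rw [if_neg h3.not_lt, if_pos h3, h4, h.next_sheet _ _ (Real.exp_pos _), sub_add_cancel]
    exact logLift_of_im_eq (by linarith)
  · have hs := Real.sin_pos_of_pos_of_lt_pi h0 h2
    have : 0 < (Complex.exp w).im := by
      rw [him]
      exact mul_pos (Real.exp_pos _) hs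
    rw [if_neg this.not_gt, if_neg this.ne']
    refine logLift_of_mem_Ioo ⟨?_, ?_⟩ <;> linarith

/-- Inside a strip between consecutive seams the lift is `G k ∘ exp`; near a seam it is the glued
function composed with `exp`. -/
theorem IsLogSurfaceExtension.differentiable_logLift (h : IsLogSurfaceExtension g G Gp Gm) :
    Differentiable ℂ (logLift G Gp) := by
  intro w
  have hpi := Real.two_pi_pos
  set k := ⌊w.im / (2 * Real.pi)⌋ with hk
  have h1 : 2 * Real.pi * k ≤ w.im := by
    have := Int.floor_le (w.im / (2 * Real.pi))
    rw [le_div_iff₀ hpi] at this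
    linarith
  have h2 : w.im < 2 * Real.pi * (k + 1) := by
    have := Int.lt_floor_add_one (w.im / (2 * Real.pi))
    rw [div_lt_iff₀ hpi] at this
    linarith
  rcases h1.eq_or_lt with h1 | h1
  · have hd := (h.analytic_across (k - 1) (Real.exp w.re) (Real.exp w.re) (Real.exp_pos _) le_rfl
      (Real.exp w.re) (Metric.mem_ball_self (Real.exp_pos _))).differentiableAt
    have he : Complex.exp w = (Real.exp w.re : ℂ) := by
      rw [Complex.exp_eq_ofReal_exp_mul_cexp_sub w k, h1]
      simp
    rw [sub_add_cancel, ← he] at hd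
    refine (hd.comp w Complex.differentiableAt_exp).congr_of_eventuallyEq ?_
    have hopen : IsOpen {z : ℂ | |z.im - 2 * Real.pi * k| < Real.pi} :=
      isOpen_lt (by fun_prop) continuous_const
    filter_upwards [hopen.mem_nhds (by simp [← h1, Real.pi_pos])] with z hz
    exact logLift_eq_gluedAcross h hz
  · have hd := (h.analytic k _ (exp_mem_cutPlane ⟨h1, h2⟩)).differentiableAt
    refine (hd.comp w Complex.differentiableAt_exp).congr_of_eventuallyEq ?_
    filter_upwards [(isOpen_Ioo.preimage Complex.continuous_im).mem_nhds
      (show w ∈ Complex.im ⁻¹' _ from ⟨h1, h2⟩)] with z hz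
    exact logLift_of_mem_Ioo hz

/-- One sheet serves the whole horizontal line, so bounds and limits in `r = exp s` transfer
directly. Taking the floor keeps the angle in `[0, 2π)`: each seam is read from the sheet above it.
-/
theorem exists_logLift_eq_polarValue (G : ℤ → ℂ → ℂ) (Gp Gm : ℤ → ℝ → ℂ) (y : ℝ) :
    ∃ k : ℤ, y - 2 * Real.pi * k ∈ Icc 0 (2 * Real.pi) ∧ ∀ s : ℝ,
      logLift G Gp (s + y * Complex.I) =
        polarValue (G k) (Gp k) (Gm k) (Real.exp s) (y - 2 * Real.pi * k) := by
  have hpi := Real.two_pi_pos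
  set k := ⌊y / (2 * Real.pi)⌋ with hk
  have h1 : 2 * Real.pi * k ≤ y := by
    have := Int.floor_le (y / (2 * Real.pi))
    rw [le_div_iff₀ hpi] at this
    linarith
  have h2 : y < 2 * Real.pi * (k + 1) := by
    have := Int.lt_floor_add_one (y / (2 * Real.pi))
    rw [div_lt_iff₀ hpi] at this
    linarith
  refine ⟨k, ⟨by linarith, by linarith⟩, fun s => ?_⟩
  have hre : (s + y * Complex.I : ℂ).re = s := by simp
  have him : (s + y * Complex.I : ℂ).im = y := by simp
  rw [polarValue]
  rcases h1.eq_or_lt with h1 | h1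
  · rw [if_pos (by linarith), logLift_of_im_eq (k := k) (by rw [him, h1]), hre]
  · rw [if_neg (by linarith), if_neg (by linarith),
      logLift_of_mem_Ioo (k := k) (by rw [him]; exact ⟨h1, h2⟩),
      Complex.exp_eq_ofReal_exp_mul_cexp_sub _ k, hre, him]

end LogLift

/-! ### Mellin integrals in the logarithmic coordinate -/

section Mellin

variable {c : ℝ} {f h : ℝ → ℂ}

theorem eq_cexp_mul_of_log (hfh : ∀ x : ℝ, 0 < x → ((x ^ c : ℝ) : ℂ) * f x = h (Real.log x))
    (s : ℝ) : f (Real.exp s) = Complex.exp (-(c * s)) * h s := by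
  have h1 := hfh _ (Real.exp_pos s)
  rw [Real.log_exp, Real.rpow_def_of_pos (Real.exp_pos s), Real.log_exp] at h1
  rw [← h1, ← mul_assoc, Complex.ofReal_exp, ← Complex.exp_add]
  push_cast
  rw [show (-(c * s) + s * c : ℂ) = 0 by ring, Complex.exp_zero, one_mul]

theorem continuousOn_of_log (hfh : ∀ x : ℝ, 0 < x → ((x ^ c : ℝ) : ℂ) * f x = h (Real.log x))
    (hc : Continuous h) : ContinuousOn f (Ioi 0) := by
  have h1 : ContinuousOn (fun x : ℝ => Complex.exp (-(c * Real.log x)) * h (Real.log x))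
      (Ioi 0) := by
    have hl : ContinuousOn Real.log (Ioi 0) :=
      Real.continuousOn_log.mono fun x hx => (mem_Ioi.1 hx).ne'
    fun_prop
  refine h1.congr fun x hx => ?_
  have := eq_cexp_mul_of_log hfh (Real.log x)
  rwa [Real.exp_log hx] at this

/-- In the logarithmic coordinate the truncated Mellin integral is a truncated Fourier integral. -/
theorem truncatedMellin_eq_intervalIntegral
    (hfh : ∀ x : ℝ, 0 < x → ((x ^ c : ℝ) : ℂ) * f x = h (Real.log x))
    (hc : Continuous h) {ρ : ℝ} (hρ : 0 < ρ) (t : ℝ) :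
    truncatedMellin c f ρ t =
      ∫ s in (-Real.log ρ)..Real.log ρ, h s * Complex.exp (t * s * Complex.I) := by
  have hfc := continuousOn_of_log hfh hc
  have hg : ContinuousOn (fun u : ℝ => f u * (u : ℂ) ^ ((c : ℂ) + t * Complex.I - 1))
      (Ioi 0) := by
    refine hfc.mul fun u hu => ContinuousAt.continuousWithinAt ?_
    exact Complex.continuousAt_ofReal_cpow_const u _ (Or.inr (mem_Ioi.1 hu).ne')
  have hsub := intervalIntegral.integral_deriv_smul_comp'' (a := -Real.log ρ) (b := Real.log ρ)
    (f := Real.exp) (f' := Real.exp)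
    (g := fun u : ℝ => f u * (u : ℂ) ^ ((c : ℂ) + t * Complex.I - 1))
    Real.continuous_exp.continuousOn (fun x _ => (Real.hasDerivAt_exp x).hasDerivWithinAt)
    Real.continuous_exp.continuousOn
    (hg.mono (by rintro _ ⟨x, -, rfl⟩; exact Real.exp_pos x))
  rw [Real.exp_neg, Real.exp_log hρ, ← one_div] at hsub
  rw [truncatedMellin, ← hsub]
  refine intervalIntegral.integral_congr fun s _ => ?_
  simp only [Function.comp_apply]
  rw [eq_cexp_mul_of_log hfh, Complex.cpow_def_of_ne_zero
    (by exact_mod_cast (Real.exp_pos s).ne'), ← Complex.ofReal_log (Real.exp_pos s).le,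
    Real.log_exp, Complex.real_smul, Complex.ofReal_exp]
  have : Complex.exp (t * s * Complex.I) = Complex.exp s * (Complex.exp (-(c * s)) *
      Complex.exp (s * (c + t * Complex.I - 1))) := by
    rw [← Complex.exp_add, ← Complex.exp_add]
    ring_nf
  rw [this]
  ring

theorem memLp_of_mem_MellinX2 (hf : f ∈ MellinX2 c)
    (hfh : ∀ x : ℝ, 0 < x → ((x ^ c : ℝ) : ℂ) * f x = h (Real.log x))
    (hc : Continuous h) : MemLp h 2 volume := by
  have hf' : MemLp (fun x : ℝ => ((x ^ (c - 1 / 2) : ℝ) : ℂ) * f x) 2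
    (volume.restrict (Ioi 0)) := hf
  rw [memLp_two_iff_integrable_sq_norm hf'.1] at hf'
  rw [memLp_two_iff_integrable_sq_norm hc.aestronglyMeasurable, ← integrableOn_univ]
  have hi := (integrableOn_image_iff_integrableOn_abs_deriv_smul (s := univ) (f := Real.exp)
    (f' := Real.exp) MeasurableSet.univ (fun x _ => (Real.hasDerivAt_exp x).hasDerivWithinAt)
    Real.exp_injective.injOn (fun x : ℝ => ‖((x ^ (c - 1 / 2) : ℝ) : ℂ) * f x‖ ^ 2)).1
    (by rw [image_univ, Real.range_exp]; exact hf')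
  refine hi.congr_fun (fun s _ => ?_) MeasurableSet.univ
  simp only [eq_cexp_mul_of_log hfh, norm_mul, Complex.norm_real, Complex.norm_exp,
    Real.rpow_def_of_pos (Real.exp_pos s), Real.log_exp, smul_eq_mul, abs_of_pos (Real.exp_pos s),
    Real.norm_of_nonneg (Real.exp_pos _).le, mul_pow, ← Real.exp_nat_mul]
  rw [← mul_assoc, ← mul_assoc, ← Real.exp_add, ← Real.exp_add]
  simp only [Complex.neg_re, Complex.mul_re, Complex.ofReal_re, Complex.ofReal_im]
  -- The Jacobian `exp s` cancels the weights exactly: `1 + 2 (c - 1/2) - 2c = 0`.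
  rw [show s + ((2 : ℕ) : ℝ) * (s * (c - 1 / 2)) + ((2 : ℕ) : ℝ) * -(c * s - 0 * 0) = 0 by
    push_cast; ring, Real.exp_zero, one_mul]

end Mellin

/-! ### Mellin-Bernstein functions are bandlimited -/

/-- A function in the Mellin-Bernstein space is, in the logarithmic coordinate, the restriction of an
entire function of exponential type which decays along horizontal lines. -/
theorem exists_entire_of_mem_MellinBernstein {c T : ℝ} {f : ℝ → ℂ} (hf : f ∈ MellinBernstein c T) :
    ∃ (H : ℂ → ℂ) (C : ℝ), Differentiable ℂ H ∧
      (∀ x : ℝ, 0 < x → ((x ^ c : ℝ) : ℂ) * f x = H (Real.log x)) ∧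
      (∀ w, ‖H w‖ ≤ C * Real.exp (T * |w.im|)) ∧
      (∀ y : ℝ, Tendsto (fun s : ℝ => H (s + y * Complex.I)) atTop (𝓝 0)) ∧
      ∀ y : ℝ, Tendsto (fun s : ℝ => H (s + y * Complex.I)) atBot (𝓝 0) := by
  obtain ⟨-, G, Gp, Gm, hG, ⟨C, -, hC⟩, hlim⟩ := hf
  refine ⟨logLift G Gp, C, hG.differentiable_logLift, fun x hx => ?_, fun w => ?_, fun y => ?_,
    fun y => ?_⟩
  · rw [logLift_of_im_eq (k := 0) (by simp), Complex.ofReal_re, Real.exp_log hx,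
      hG.extends_base x hx]
  · obtain ⟨k, hk, h⟩ := exists_logLift_eq_polarValue G Gp Gm w.im
    have := hC k _ hk _ (Real.exp_pos w.re)
    rwa [← h, Complex.re_add_im, add_sub_cancel] at this
  · obtain ⟨k, hk, h⟩ := exists_logLift_eq_polarValue G Gp Gm y
    simp only [h]
    exact ((hlim k).2.tendsto_at hk).comp Real.tendsto_exp_atTop
  · obtain ⟨k, hk, h⟩ := exists_logLift_eq_polarValue G Gp Gm y
    simp only [h]
    exact ((hlim k).1.tendsto_at hk).comp Real.tendsto_exp_atBot_nhdsGT

/-- The Mellin transform of a function in the Mellin-Bernstein space vanishes outside `[-T, T]`. -/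
theorem IsMellinL2.ae_eq_zero_of_mem_MellinBernstein {c T : ℝ} {f F : ℝ → ℂ}
    (hf : f ∈ MellinBernstein c T) (hF : IsMellinL2 c f F) :
    ∀ᵐ t ∂(volume : Measure ℝ), T < |t| → F t = 0 := by
  obtain ⟨H, C, hH, hfH, hC, htop, hbot⟩ := exists_entire_of_mem_MellinBernstein hf
  have hc : Continuous fun s : ℝ => H s := hH.continuous.comp Complex.continuous_ofReal
  have htr : ∀ (n : ℕ) (t : ℝ), truncatedMellin c f (Real.exp n) t =
      ∫ s in (-n : ℝ)..n, H s * Complex.exp (t * s * Complex.I) := fun n t => by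
    rw [truncatedMellin_eq_intervalIntegral (h := fun s : ℝ => H s) hfH hc (Real.exp_pos _),
      Real.log_exp]
  have hmeas : ∀ n : ℕ, AEStronglyMeasurable (truncatedMellin c f (Real.exp n)) volume := by
    intro n
    have : truncatedMellin c f (Real.exp n) =
        fun t : ℝ => ∫ s in (-n : ℝ)..n, H s * Complex.exp (t * s * Complex.I) := funext (htr n)
    have hHc := hH.continuous
    rw [this]
    exact (intervalIntegral.continuous_parametric_intervalIntegral_of_continuous'
      (by fun_prop) _ _).aestronglyMeasurable
  -- Along `ρ = exp n` the convergence in `L²` becomes that of a sequence, from which an almost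
  -- everywhere convergent subsequence is extracted.
  have hexp : Tendsto (fun n : ℕ => Real.exp n) atTop atTop :=
    Real.tendsto_exp_atTop.comp tendsto_natCast_atTop_atTop
  have hconv : Tendsto (fun n : ℕ => eLpNorm (truncatedMellin c f (Real.exp n) - F) 2 volume)
      atTop (𝓝 0) := by
    refine (hF.2.comp hexp).congr fun n => ?_
    exact eLpNorm_sub_comm F (truncatedMellin c f (Real.exp n)) 2 volume
  obtain ⟨ns, hns, hae⟩ :=
    (tendstoInMeasure_of_tendsto_eLpNorm two_ne_zero hmeas hF.1.1 hconv).exists_seq_tendsto_ae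
  filter_upwards [hae] with t ht hTt
  refine tendsto_nhds_unique ht ?_
  simp only [htr]
  exact (tendsto_intervalIntegral_mul_cexp_of_lt_abs hH hC htop hbot hTt).comp
    (tendsto_natCast_atTop_atTop.comp hns.tendsto_atTop)

theorem essSupport_subset_Icc {F : ℝ → ℂ} {T : ℝ}
    (hF : ∀ᵐ t ∂(volume : Measure ℝ), T < |t| → F t = 0) : essSupport F ⊆ Icc (-T) T := by
  intro t ht
  by_contra hmem
  refine ht ⟨{s | T < |s|}, (isOpen_lt continuous_const continuous_abs).mem_nhds ?_, hF⟩
  rw [mem_Icc, ← abs_le] at hmem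
  exact not_le.1 hmem

theorem MellinBernstein_subset_MellinBandlimited (c T : ℝ) :
    MellinBernstein c T ⊆ MellinBandlimited c T := by
  intro f hf
  obtain ⟨H, C, hH, hfH, -⟩ := exists_entire_of_mem_MellinBernstein hf
  have hc : Continuous fun s : ℝ => H s := hH.continuous.comp Complex.continuous_ofReal
  obtain ⟨F, hF2, hF⟩ := exists_tendsto_eLpNorm_sub_intervalIntegral hc
    (memLp_of_mem_MellinX2 (h := fun s : ℝ => H s) hf.1 hfH hc)
  have hM : IsMellinL2 c f F := by
    refine ⟨hF2, (hF.comp Real.tendsto_log_atTop).congr' ?_⟩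
    filter_upwards [eventually_gt_atTop 0] with ρ hρ
    simp only [Function.comp_apply,
      truncatedMellin_eq_intervalIntegral (h := fun s : ℝ => H s) hfH hc hρ]
  exact ⟨hf.1, continuousOn_of_log (h := fun s : ℝ => H s) hfH hc, F, hM,
    hM.ae_eq_zero_of_mem_MellinBernstein hf⟩

theorem theorem6 (c T : ℝ) (hT : 0 < T) :
    MellinBernstein c T ⊆ MellinBandlimited c T ∧
      ∀ f ∈ MellinBernstein c T, ∀ F : ℝ → ℂ, IsMellinL2 c f F →
        essSupport F ⊆ Icc (-T) T :=
  ⟨MellinBernstein_subset_MellinBandlimited c T, fun _ hf _ hF =>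
    essSupport_subset_Icc (hF.ae_eq_zero_of_mem_MellinBernstein hf)⟩
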